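/- Let $n\ge 2$ and call linear maps $\mathbb C^{n\times n}\to\mathbb C^{n\times n}$ superoperators, with identity $\mathcal I$ and with products and powers meaning composition. For $p\in\mathbb C$ put $\Lambda_p X=pX+(1-p)\frac{I}{n}\operatorname{Tr}X$, and define the twirling hyperprojector with respect to the whole unitary group by $$\mathfrak P(\Phi)=\int_{U(n)}U^\dagger\,\Phi(U\,\cdot\,U^\dagger)\,U\,dU,$$ where $dU$ is the Haar measure on $U(n)$ with total mass $1$. Let $\mathcal L_0=\gamma(\Lambda_p-\mathcal I)$ with $\gamma>0$ and real $p\in[-\frac1{n^2-1},1]$, and let $\mathcal L_I$ be a superoperator with $\operatorname{Tr}\mathcal L_I(X)=0$ for all $X\in\mathbb C^{n\times n}$. For $\lambda\in\mathbb C$ and $t,t_0\in\mathbb R$ let $\Phi_\lambda(t,t_0)$ be the solution of $$\frac{d}{dt}\Phi_\lambda(t,t_0)=(\mathcal L_0+\lambda\mathcal L_I)\,\Phi_\lambda(t,t_0),\qquad \Phi_\lambda(t_0,t_0)=\mathcal I .$$ Theorem. There is a family of superoperators $\mathfrak K_\lambda(t,t_0)$ such that the following hold for all $t,t_0\in\mathbb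 R$. (i) There is $\lambda_0>0$ such that for all $|\lambda|<\lambda_0$ and all $s$ in the closed interval with end points $t_0$ and $t$, the superoperator $\mathfrak P(\Phi_\lambda(s,t_0))$ is invertible and $$\frac{d}{ds}\mathfrak P(\Phi_\lambda(s,t_0))=\mathfrak K_\lambda(s,t_0)\,\mathfrak P(\Phi_\lambda(s,t_0)).$$ (In particular $\mathfrak K_\lambda(s,t_0)$ is uniquely determined for these $\lambda$ and $s$.) (ii) As $\lambda\to0$, $\mathfrak K_\lambda(t,t_0)$ has the asymptotic expansion $\sum_{k\ge0}\lambda^k\mathfrak K_k(t)$, that is, for every $N\ge 0$, $$\mathfrak K_\lambda(t,t_0)=\sum_{k=0}^{N}\lambda^k\,\mathfrak K_k(t)+O(\lambda^{N+1}),$$ where $\mathfrak K_0(t)=\mathcal L_0$ and, for $k\ge1$, $$\mathfrak K_k(t)=(t-t_0)^{k-1}\sum_{q=0}^{k-1}(-1)^q\sum_{\substack{k_0+\cdots+k_q=k\\ k_j\ge1}}\frac{1}{(k_0-1)!\,k_1!\cdots k_q!}\;\mathfrak P(\mathcal L_I^{k_0})\,\mathfrak P(\mathcal L_I^{k_1})\cdots\mathfrak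 P(\mathcal L_I^{k_q}).$$ -/

import Mathlib

open MeasureTheory Filter Topology Asymptotics

open scoped Matrix.Norms.L2Operator

/-- Superoperators: `ℂ`-linear maps `ℂ^{n×n} → ℂ^{n×n}` (continuity is automatic in finite
dimension; matrices and superoperators carry their operator norms). The ring multiplication `*`
is composition and `1` is the identity superoperator. -/
def SuperOp (n : ℕ) : Type :=
  Matrix (Fin n) (Fin n) ℂ →L[ℂ] Matrix (Fin n) (Fin n) ℂ

namespace SuperOp

variable {n : ℕ}

noncomputable instance instNormedRing : NormedRing (SuperOp n) :=
  inferInstanceAs (NormedRing (Matrix (Fin n) (Fin n) ℂ →L[ℂ] Matrix (Fin n) (Fin n) ℂ))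

noncomputable instance instNormedAlgebra : NormedAlgebra ℂ (SuperOp n) :=
  inferInstanceAs (NormedAlgebra ℂ (Matrix (Fin n) (Fin n) ℂ →L[ℂ] Matrix (Fin n) (Fin n) ℂ))

instance instCompleteSpace : CompleteSpace (SuperOp n) :=
  inferInstanceAs (CompleteSpace (Matrix (Fin n) (Fin n) ℂ →L[ℂ] Matrix (Fin n) (Fin n) ℂ))

instance instFunLike : FunLike (SuperOp n) (Matrix (Fin n) (Fin n) ℂ)
    (Matrix (Fin n) (Fin n) ℂ) :=
  inferInstanceAs (FunLike (Matrix (Fin n) (Fin n) ℂ →L[ℂ] Matrix (Fin n) (Fin n) ℂ) _ _)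

/-- A linear map on matrices as a superoperator. -/
noncomputable def ofLinear
    (f : Matrix (Fin n) (Fin n) ℂ →ₗ[ℂ] Matrix (Fin n) (Fin n) ℂ) : SuperOp n :=
  LinearMap.toContinuousLinearMap f

theorem ofLinear_apply (f : Matrix (Fin n) (Fin n) ℂ →ₗ[ℂ] Matrix (Fin n) (Fin n) ℂ)
    (X : Matrix (Fin n) (Fin n) ℂ) : ofLinear f X = f X := rfl

theorem one_apply (X : Matrix (Fin n) (Fin n) ℂ) : (1 : SuperOp n) X = X := rfl

theorem mul_apply (A B : SuperOp n) (X : Matrix (Fin n) (Fin n) ℂ) : (A * B) X = A (B X) := rfl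

theorem add_apply (A B : SuperOp n) (X : Matrix (Fin n) (Fin n) ℂ) : (A + B) X = A X + B X := rfl

theorem smul_apply (c : ℂ) (A : SuperOp n) (X : Matrix (Fin n) (Fin n) ℂ) :
    (c • A) X = c • A X := rfl

end SuperOp

/-- The unitary group `U(n)`. -/
abbrev UGroup (n : ℕ) : Type := Matrix.unitaryGroup (Fin n) ℂ

instance UGroup.instCompactSpace (n : ℕ) : CompactSpace (UGroup n) := by
  have h : IsCompact (unitary (Matrix (Fin n) (Fin n) ℂ) : Set (Matrix (Fin n) (Fin n) ℂ)) := by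
    refine Metric.isCompact_of_isClosed_isBounded isClosed_unitary ?_
    rw [isBounded_iff_forall_norm_le]
    refine ⟨‖(1 : Matrix (Fin n) (Fin n) ℂ)‖ + 1, fun U hU => ?_⟩
    have h1 : ‖U‖ * ‖U‖ = ‖(1 : Matrix (Fin n) (Fin n) ℂ)‖ := by
      rw [← CStarRing.norm_star_mul_self, (Unitary.mem_iff.mp hU).1]
    nlinarith [norm_nonneg U, norm_nonneg (1 : Matrix (Fin n) (Fin n) ℂ)]
  exact isCompact_iff_compactSpace.mp h

noncomputable instance UGroup.instMeasurableSpace (n : ℕ) : MeasurableSpace (UGroup n) := borel _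

instance UGroup.instBorelSpace (n : ℕ) : BorelSpace (UGroup n) := ⟨rfl⟩

/-- The Haar measure on `U(n)`, normalized so that `U(n)` has measure `1`. -/
noncomputable def unitaryHaar (n : ℕ) : Measure (UGroup n) :=
  Measure.haarMeasure (⊤ : TopologicalSpace.PositiveCompacts (UGroup n))

/-- The superoperator `X ↦ A X Aᴴ`. -/
noncomputable def conjBy {n : ℕ} (A : Matrix (Fin n) (Fin n) ℂ) : SuperOp n :=
  SuperOp.ofLinear
    (LinearMap.mulLeft ℂ A ∘ₗ LinearMap.mulRight ℂ A.conjTranspose)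

/-- The twirling hyperprojector with respect to the whole unitary group,
`Φ ↦ ∫_{U(n)} Uᴴ Φ(U · Uᴴ) U dU`. -/
noncomputable def twirl {n : ℕ} (Φ : SuperOp n) : SuperOp n :=
  ∫ U : UGroup n, conjBy (U : Matrix (Fin n) (Fin n) ℂ).conjTranspose * Φ *
    conjBy (U : Matrix (Fin n) (Fin n) ℂ) ∂(unitaryHaar n)

/-- `Λ_p X = p X + (1 - p) (Tr X / n) I`. -/
noncomputable def depolarizing (n : ℕ) (p : ℂ) : SuperOp n :=
  SuperOp.ofLinear
    (p • LinearMap.id +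
      ((1 - p) / (n : ℂ)) •
        (Matrix.traceLinearMap (Fin n) ℂ ℂ).smulRight (1 : Matrix (Fin n) (Fin n) ℂ))

/-- The free generator `γ (Λ_p - 𝓘)`. -/
noncomputable def freeGenerator (n : ℕ) (γ p : ℝ) : SuperOp n :=
  (γ : ℂ) • (depolarizing n (p : ℂ) - 1)

/-- `Φ t t₀` is the propagator of the time-independent generator `L`: for every `t₀`,
`d/dt Φ(t, t₀) = L Φ(t, t₀)` and `Φ(t₀, t₀) = 𝓘`. -/
def IsPropagator {n : ℕ} (L : SuperOp n) (Φ : ℝ → ℝ → SuperOp n) : Prop :=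
  ∀ t₀ : ℝ, Φ t₀ t₀ = 1 ∧ ∀ t : ℝ, HasDerivAt (fun s => Φ s t₀) (L * Φ t t₀) t

/-- The compositions `k = k_0 + ⋯ + k_q` of `k` into `q + 1` parts, all `k_j ≥ 1`. -/
def compositionsOf (k q : ℕ) : Finset (Fin (q + 1) → ℕ) :=
  (Finset.Nat.antidiagonalTuple (q + 1) k).filter fun κ => ∀ j, 1 ≤ κ j

/-- The coefficients of the expansion: `𝔎_0 = L₀` and, for `k ≥ 1`,
`𝔎_k = (t-t₀)^{k-1} ∑_{q=0}^{k-1} (-1)^q ∑_{k_0+⋯+k_q=k, k_j≥1}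
  1/((k_0-1)! k_1! ⋯ k_q!) 𝔓(L_I^{k_0}) 𝔓(L_I^{k_1}) ⋯ 𝔓(L_I^{k_q})`. -/
noncomputable def cumulant {n : ℕ} (L₀ LI : SuperOp n) (t t₀ : ℝ) (k : ℕ) : SuperOp n :=
  if k = 0 then L₀ else
    (((t - t₀) ^ (k - 1) : ℝ) : ℂ) •
      ∑ q ∈ Finset.range k, (-1 : ℂ) ^ q •
        ∑ κ ∈ compositionsOf k q,
          (1 / ((Nat.factorial (κ 0 - 1) : ℂ) *
              ∏ j : Fin q, (Nat.factorial (κ j.succ) : ℂ))) •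
            (List.ofFn fun j : Fin (q + 1) => twirl (LI ^ κ j)).prod

/-! Write $P$ for `traceProj`, $c=\gamma(1-p)$ and $\tau=t-t_0$. Then $\mathcal L_0=-c(1-P)$ and
$P\mathcal L_I=0$, so $P\Phi=P$, and $\Phi(1-P)$ solves a linear equation with generator
$-c+\lambda\mathcal L_I$, whose scalar part splits off. The twirl is multiplicative over factors
commuting with all conjugations, such as $1-P$. A twirled map sends $I$ to a multiple of $I$, so
twirling a map with traceless range gives one that kills $I$. Hence (`twirl_propagator`) $\mathfrak
P(\Phi)=P+e^{-c\tau}(T(\lambda\tau)-P)$ with $T(z)=\mathfrak P(e^{z\mathcal L_I})$.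

This is invertible whenever $T(\lambda\tau)$ is, hence for small $\lambda\tau$, and its generator is
$\mathcal L_0+\lambda\,T'T^{-1}$ at $z=\lambda\tau$.

Formally $T'T^{-1}=\sum_q(-1)^qT'(T-1)^q$, which explains the sum over compositions: the first part
comes from $T'$ and carries $(k_0-1)!$, the others come from $T-1$. The proof instead checks the
Cauchy recursion $VT=T'$ on coefficients (`sum_orderedCumulant_mul`) and turns it into an asymptotic
expansion (`isBigO_mul_inverse_sub_sum`). -/

/-! ### Combinatorics of compositions. -/

section OrderedCumulant

variable {R : Type*} [Ring R] [Algebra ℂ R]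

/-- The weighted sum of the ordered products `P k₀ ⋯ P k_q` over the compositions
`k = k₀ + ⋯ + k_q`, with weights `1 / ((k₀ - 1)! k₁! ⋯ k_q!)`. -/
noncomputable def orderedTerm (P : ℕ → R) (k q : ℕ) : R :=
  ∑ κ ∈ compositionsOf k q,
    (1 / ((Nat.factorial (κ 0 - 1) : ℂ) * ∏ j : Fin q, (Nat.factorial (κ j.succ) : ℂ))) •
      (List.ofFn fun j : Fin (q + 1) => P (κ j)).prod

/-- The alternating sum of the ordered products over all compositions of `k`. -/
noncomputable def orderedCumulant (P : ℕ → R) (k : ℕ) : R :=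
  ∑ q ∈ Finset.range k, (-1 : ℂ) ^ q • orderedTerm P k q

theorem mem_compositionsOf {k q : ℕ} {κ : Fin (q + 1) → ℕ} :
    κ ∈ compositionsOf k q ↔ ∑ i, κ i = k ∧ ∀ j, 1 ≤ κ j := by
  simp [compositionsOf, Finset.Nat.mem_antidiagonalTuple]

theorem compositionsOf_eq_empty {k q : ℕ} (h : k ≤ q) : compositionsOf k q = ∅ := by
  refine Finset.eq_empty_of_forall_notMem fun κ hκ => ?_
  obtain ⟨h1, h2⟩ := mem_compositionsOf.1 hκ
  have h3 : ∑ _i : Fin (q + 1), 1 ≤ ∑ i, κ i := Finset.sum_le_sum fun i _ => h2 i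
  simp at h3
  omega

theorem orderedTerm_eq_zero (P : ℕ → R) {k q : ℕ} (h : k ≤ q) : orderedTerm P k q = 0 := by
  simp [orderedTerm, compositionsOf_eq_empty h]

/-- Terms with $q\ge k$ vanish; a range of $q$ independent of $k$ allows sums over $k$ and $q$ to be
interchanged. -/
theorem orderedCumulant_eq_sum (P : ℕ → R) {k M : ℕ} (h : k ≤ M) :
    orderedCumulant P k = ∑ q ∈ Finset.range M, (-1 : ℂ) ^ q • orderedTerm P k q := by
  refine Finset.sum_subset (Finset.range_mono h) fun q _ hq => ?_
  rw [orderedTerm_eq_zero P (by simpa using hq), smul_zero]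

theorem orderedTerm_zero (P : ℕ → R) {k : ℕ} (hk : 1 ≤ k) :
    orderedTerm P k 0 = (1 / (Nat.factorial (k - 1) : ℂ)) • P k := by
  have h : compositionsOf k 0 = {fun _ => k} := by
    ext κ
    simp only [mem_compositionsOf, Finset.mem_singleton]
    constructor
    · rintro ⟨h, -⟩
      funext i
      rw [Fin.fin_one_eq_zero i]
      simpa using h
    · rintro rfl
      simpa using hk
  simp [orderedTerm, h]

/-- Split off the last part $k-j\ge1$ of each composition; its factor stands rightmost in the
product. -/
theorem orderedTerm_succ (P : ℕ → R) (k q : ℕ) :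
    orderedTerm P k (q + 1) = ∑ j ∈ Finset.range k,
      orderedTerm P j q * ((1 / (Nat.factorial (k - j) : ℂ)) • P (k - j)) := by
  simp only [orderedTerm, Finset.sum_mul]
  rw [Finset.sum_sigma' (Finset.range k) (fun j => compositionsOf j q)]
  refine Finset.sum_bij' (fun κ _ => ⟨∑ i, Fin.init κ i, Fin.init κ⟩)
    (fun x _ => Fin.snoc x.2 (k - x.1)) ?_ ?_ ?_ ?_ ?_
  · intro κ hκ
    obtain ⟨h1, h2⟩ := mem_compositionsOf.1 hκ
    rw [Fin.sum_univ_castSucc] at h1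
    have h3 := h2 (Fin.last _)
    simp only [Finset.mem_sigma, Finset.mem_range, mem_compositionsOf, Fin.init, true_and]
    exact ⟨by omega, fun j => h2 _⟩
  · rintro ⟨j, κ⟩ hx
    simp only [Finset.mem_sigma, Finset.mem_range, mem_compositionsOf] at hx
    obtain ⟨hj, h1, h2⟩ := hx
    rw [mem_compositionsOf, Fin.sum_univ_castSucc]
    simp only [Fin.snoc_castSucc, Fin.snoc_last]
    refine ⟨by omega, fun i => ?_⟩
    refine Fin.lastCases ?_ (fun i => ?_) i
    · rw [Fin.snoc_last]; omega
    · rw [Fin.snoc_castSucc]; exact h2 i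
  · intro κ hκ
    obtain ⟨h1, -⟩ := mem_compositionsOf.1 hκ
    rw [Fin.sum_univ_castSucc] at h1
    have h3 : k - ∑ i, Fin.init κ i = κ (Fin.last _) := by
      simp only [Fin.init]; omega
    simp only [h3, Fin.snoc_init_self]
  · rintro ⟨j, κ⟩ hx
    simp only [Finset.mem_sigma, Finset.mem_range, mem_compositionsOf] at hx
    obtain ⟨hj, rfl, h2⟩ := hx
    simp
  · intro κ hκ
    obtain ⟨h1, -⟩ := mem_compositionsOf.1 hκ
    rw [Fin.sum_univ_castSucc] at h1
    have h3 : k - ∑ i, Fin.init κ i = κ (Fin.last _) := by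
      simp only [Fin.init]; omega
    simp only [h3]
    rw [List.ofFn_succ' (fun j => P (κ j)), List.concat_eq_append, List.prod_append,
      List.prod_singleton, smul_mul_smul_comm, Fin.prod_univ_castSucc, one_div_mul_one_div,
      mul_assoc]
    rfl

/-- The Cauchy product recursion for the ordered cumulants. -/
theorem sum_orderedCumulant_mul (P : ℕ → R) (h0 : P 0 = 1) (m : ℕ) :
    ∑ j ∈ Finset.range (m + 1),
      orderedCumulant P (j + 1) * ((1 / (Nat.factorial (m - j) : ℂ)) • P (m - j)) =
        (1 / (Nat.factorial m : ℂ)) • P (m + 1) := by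
  -- The term $q=0$ gives the first summand; in the others, splitting off the last part lowers $q$
  -- by one and flips the sign.
  have key : orderedCumulant P (m + 1) = (1 / (Nat.factorial m : ℂ)) • P (m + 1) -
      ∑ j ∈ Finset.range (m + 1),
        orderedCumulant P j * ((1 / (Nat.factorial (m + 1 - j) : ℂ)) • P (m + 1 - j)) := by
    rw [orderedCumulant, Finset.sum_range_succ', orderedTerm_zero P (by omega)]
    have h : ∀ j ∈ Finset.range (m + 1),
        orderedCumulant P j * ((1 / (Nat.factorial (m + 1 - j) : ℂ)) • P (m + 1 - j)) =
          ∑ q ∈ Finset.range m, (-1 : ℂ) ^ q • (orderedTerm P j q *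
            ((1 / (Nat.factorial (m + 1 - j) : ℂ)) • P (m + 1 - j))) := by
      intro j hj
      rw [orderedCumulant_eq_sum P (Nat.lt_succ_iff.1 (Finset.mem_range.1 hj)), Finset.sum_mul]
      exact Finset.sum_congr rfl fun q _ => smul_mul_assoc _ _ _
    rw [Finset.sum_congr rfl h, Finset.sum_comm]
    simp only [orderedTerm_succ P (m + 1), ← Finset.smul_sum, pow_succ, mul_neg, mul_one, neg_smul,
      Finset.sum_neg_distrib, pow_zero, one_smul, Nat.add_sub_cancel]
    abel
  -- The top term $j=m$ carries the factor `P 0 = 1`; after an index shift the remaining terms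
  -- cancel against the sum in `key`, whose $j=0$ term vanishes.
  rw [Finset.sum_range_succ, key, Finset.sum_range_succ' _ m]
  have h1 : orderedCumulant P 0 = 0 := by simp [orderedCumulant]
  simp [h1, h0, Nat.add_sub_add_right]

end OrderedCumulant

/-! ### Asymptotic expansions at zero. -/

section Expansion

variable {A : Type*} [NormedRing A] [NormedAlgebra ℂ A]

theorem isBigO_smul_const_pow (N : ℕ) (a : A) :
    (fun z : ℂ => z ^ N • a) =O[𝓝 0] fun z : ℂ => z ^ N := by
  refine IsBigO.of_bound ‖a‖ (Eventually.of_forall fun z => ?_)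
  rw [norm_smul, mul_comm]

theorem sum_range_sum_smul_mul (v a b : ℕ → A)
    (h : ∀ m, ∑ j ∈ Finset.range (m + 1), v j * a (m - j) = b m) (N : ℕ) (z : ℂ) :
    ∑ j ∈ Finset.range N, (z ^ j • v j) * ∑ k ∈ Finset.range (N - j), z ^ k • a k =
      ∑ m ∈ Finset.range N, z ^ m • b m := by
  simp only [← h, Finset.mul_sum, Finset.smul_sum]
  rw [Finset.sum_sigma', Finset.sum_sigma']
  refine Finset.sum_bij' (fun x _ => ⟨x.1 + x.2, x.1⟩) (fun x _ => ⟨x.2, x.1 - x.2⟩) ?_ ?_ ?_ ?_ ?_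
  · rintro ⟨j, k⟩ hx
    simp only [Finset.mem_sigma, Finset.mem_range] at hx ⊢
    omega
  · rintro ⟨m, j⟩ hx
    simp only [Finset.mem_sigma, Finset.mem_range] at hx ⊢
    omega
  · rintro ⟨j, k⟩ hx
    simp
  · rintro ⟨m, j⟩ hx
    simp only [Finset.mem_sigma, Finset.mem_range] at hx
    have : j + (m - j) = m := by omega
    simp [this]
  · rintro ⟨j, k⟩ hx
    rw [smul_mul_smul_comm, pow_add, Nat.add_sub_cancel_left]

/-- The asymptotic expansion of a quotient, with coefficients given by the Cauchy recursion. -/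
theorem isBigO_mul_inverse_sub_sum [CompleteSpace A] {F G : ℂ → A} {v a b : ℕ → A}
    (hF : ∀ N, (fun z => F z - ∑ k ∈ Finset.range N, z ^ k • a k) =O[𝓝 0] fun z : ℂ => z ^ N)
    (hG : ∀ N, (fun z => G z - ∑ k ∈ Finset.range N, z ^ k • b k) =O[𝓝 0] fun z : ℂ => z ^ N)
    (hFc : ContinuousAt F 0) (hF0 : F 0 = 1)
    (h : ∀ m, ∑ j ∈ Finset.range (m + 1), v j * a (m - j) = b m) (N : ℕ) :
    (fun z => G z * Ring.inverse (F z) - ∑ j ∈ Finset.range N, z ^ j • v j)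
      =O[𝓝 0] fun z : ℂ => z ^ N := by
  have hu : ∀ᶠ z in 𝓝 (0 : ℂ), IsUnit (F z) :=
    hFc.eventually (Units.isOpen.mem_nhds (by simp [hF0]))
  have hinv : (fun z => Ring.inverse (F z)) =O[𝓝 0] fun _ => (1 : ℂ) := by
    have hc : ContinuousAt (fun z => Ring.inverse (F z)) 0 := by
      have h1 : ContinuousAt Ring.inverse (F 0) := by
        rw [hF0]; exact NormedRing.inverse_continuousAt 1
      exact ContinuousAt.comp (f := F) h1 hFc
    exact hc.tendsto.isBigO_one ℂ
  -- Estimate before dividing by `F`: truncating `F` at order `N - j` against $z^j$ makes each error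
  -- $O(z^N)$, and the truncated products sum exactly to the truncation of `G`.
  have hmain : (fun z => G z - (∑ j ∈ Finset.range N, z ^ j • v j) * F z)
      =O[𝓝 0] fun z : ℂ => z ^ N := by
    have h1 : (fun z => ∑ j ∈ Finset.range N,
        (z ^ j • v j) * (F z - ∑ k ∈ Finset.range (N - j), z ^ k • a k))
        =O[𝓝 0] fun z : ℂ => z ^ N := by
      refine IsBigO.fun_sum (fun j hj => ?_)
      refine ((isBigO_smul_const_pow j (v j)).mul (hF (N - j))).congr_right fun z => ?_
      rw [← pow_add]
      congr 1
      have := Finset.mem_range.1 hj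
      omega
    refine ((hG N).sub h1).congr_left fun z => ?_
    simp only [mul_sub, Finset.sum_sub_distrib]
    rw [sum_range_sum_smul_mul v a b h N z, Finset.sum_mul]
    abel
  refine ((hmain.mul hinv).congr' ?_ ?_)
  · filter_upwards [hu] with z hz
    rw [sub_mul, mul_assoc, Ring.mul_inverse_cancel _ hz, mul_one]
  · exact Eventually.of_forall fun z => mul_one _

theorem isBigO_exp_smul_sub_sum [CompleteSpace A] (L : A) (N : ℕ) :
    (fun z : ℂ => NormedSpace.exp (z • L) -
      ∑ k ∈ Finset.range N, z ^ k • ((1 / (Nat.factorial k : ℂ)) • L ^ k))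
      =O[𝓝 0] fun z : ℂ => z ^ N := by
  have h1 := (NormedSpace.exp_hasFPowerSeriesAt_zero (𝕂 := ℂ) (𝔸 := A)).isBigO_sub_partialSum_pow N
  have h2 : Tendsto (fun z : ℂ => z • L) (𝓝 0) (𝓝 0) := by
    have : Continuous fun z : ℂ => z • L := by fun_prop
    simpa using this.tendsto 0
  have h3 := h1.comp_tendsto h2
  have h4 : (fun z : ℂ => ‖z • L‖ ^ N) =O[𝓝 0] fun z : ℂ => z ^ N := by
    refine IsBigO.of_bound (‖L‖ ^ N) (Eventually.of_forall fun z => ?_)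
    rw [norm_smul, mul_pow, norm_mul, norm_pow, norm_pow, norm_pow, norm_norm, norm_norm, mul_comm]
  refine (h3.trans h4).congr_left fun z => ?_
  simp only [Function.comp_apply, zero_add, FormalMultilinearSeries.partialSum,
    NormedSpace.expSeries_apply_eq, smul_pow, one_div]
  congr 1
  exact Finset.sum_congr rfl fun k _ => smul_comm _ _ _

end Expansion

/-! ### The twirl and its commutation properties. -/

section Twirl

variable {n : ℕ}

theorem SuperOp.ext {A B : SuperOp n} (h : ∀ X, A X = B X) : A = B :=
  ContinuousLinearMap.ext h

theorem SuperOp.sub_apply (A B : SuperOp n) (X : Matrix (Fin n) (Fin n) ℂ) :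
    (A - B) X = A X - B X := rfl

theorem SuperOp.apply_smul (A : SuperOp n) (c : ℂ) (X : Matrix (Fin n) (Fin n) ℂ) :
    A (c • X) = c • A X := ContinuousLinearMap.map_smul A c X

instance SuperOp.instFiniteDimensional : FiniteDimensional ℂ (SuperOp n) :=
  inferInstanceAs
    (FiniteDimensional ℂ (Matrix (Fin n) (Fin n) ℂ →L[ℂ] Matrix (Fin n) (Fin n) ℂ))

theorem conjBy_apply (A X : Matrix (Fin n) (Fin n) ℂ) :
    conjBy A X = A * X * A.conjTranspose := (mul_assoc _ _ _).symm

theorem conjBy_mul (A B : Matrix (Fin n) (Fin n) ℂ) : conjBy (A * B) = conjBy A * conjBy B := by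
  refine SuperOp.ext fun X => ?_
  simp only [SuperOp.mul_apply, conjBy_apply, Matrix.conjTranspose_mul, mul_assoc]

theorem conjBy_one : conjBy (1 : Matrix (Fin n) (Fin n) ℂ) = 1 := by
  refine SuperOp.ext fun X => ?_
  simp [conjBy_apply, SuperOp.one_apply]

theorem UGroup.conjTranspose_mul_self (U : UGroup n) :
    (U : Matrix (Fin n) (Fin n) ℂ).conjTranspose * (U : Matrix (Fin n) (Fin n) ℂ) = 1 :=
  Matrix.mem_unitaryGroup_iff'.1 U.2

theorem UGroup.self_mul_conjTranspose (U : UGroup n) :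
    (U : Matrix (Fin n) (Fin n) ℂ) * (U : Matrix (Fin n) (Fin n) ℂ).conjTranspose = 1 :=
  Matrix.mem_unitaryGroup_iff.1 U.2

theorem continuous_conjBy : Continuous (conjBy : Matrix (Fin n) (Fin n) ℂ → SuperOp n) := by
  have h : (conjBy : Matrix (Fin n) (Fin n) ℂ → SuperOp n) = fun A =>
      ContinuousLinearMap.mulLeftRight ℂ (Matrix (Fin n) (Fin n) ℂ) A A.conjTranspose := by
    funext A
    refine SuperOp.ext fun X => ?_
    rw [conjBy_apply]
    rfl
  rw [h]
  have h2 : Continuous fun A : Matrix (Fin n) (Fin n) ℂ => A.conjTranspose :=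
    continuous_id.matrix_conjTranspose
  exact ((ContinuousLinearMap.mulLeftRight ℂ (Matrix (Fin n) (Fin n) ℂ)).continuous).clm_apply h2

/-- The integrand of the twirl. -/
noncomputable def twirlIntegrand (Ψ : SuperOp n) (U : UGroup n) : SuperOp n :=
  conjBy (U : Matrix (Fin n) (Fin n) ℂ).conjTranspose * Ψ *
    conjBy (U : Matrix (Fin n) (Fin n) ℂ)

theorem twirl_eq_integral (Ψ : SuperOp n) :
    twirl Ψ = ∫ U : UGroup n, twirlIntegrand Ψ U ∂(unitaryHaar n) := rfl

instance unitaryHaar.instIsHaarMeasure : (unitaryHaar n).IsHaarMeasure :=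
  inferInstanceAs (Measure.haarMeasure (⊤ : TopologicalSpace.PositiveCompacts
    (UGroup n))).IsHaarMeasure

instance unitaryHaar.instIsProbabilityMeasure : IsProbabilityMeasure (unitaryHaar n) :=
  ⟨Measure.haarMeasure_self (K₀ := (⊤ : TopologicalSpace.PositiveCompacts (UGroup n)))⟩

/-- A right translate of Haar measure is again a Haar probability measure, so uniqueness applies. -/
instance unitaryHaar.instIsMulRightInvariant : (unitaryHaar n).IsMulRightInvariant := by
  refine ⟨fun g => ?_⟩
  have : IsProbabilityMeasure (Measure.map (· * g) (unitaryHaar n)) :=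
    Measure.isProbabilityMeasure_map (measurable_mul_const g).aemeasurable
  exact Measure.isHaarMeasure_eq_of_isProbabilityMeasure _ _

theorem continuous_twirlIntegrand (Ψ : SuperOp n) : Continuous (twirlIntegrand Ψ) := by
  have h : Continuous fun U : UGroup n => (U : Matrix (Fin n) (Fin n) ℂ) := continuous_subtype_val
  exact ((continuous_conjBy.comp h.matrix_conjTranspose).mul continuous_const).mul
    (continuous_conjBy.comp h)

theorem integrable_twirlIntegrand (Ψ : SuperOp n) :
    Integrable (twirlIntegrand Ψ) (unitaryHaar n) :=
  (continuous_twirlIntegrand Ψ).integrable_of_hasCompactSupport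
    (HasCompactSupport.of_compactSpace _)

variable (n) in
/-- The twirl as a continuous linear map. -/
noncomputable def twirlCLM : SuperOp n →L[ℂ] SuperOp n :=
  LinearMap.toContinuousLinearMap
    { toFun := twirl
      map_add' := fun A B => by
        simp only [twirl_eq_integral]
        rw [← integral_add (integrable_twirlIntegrand A) (integrable_twirlIntegrand B)]
        simp only [twirlIntegrand, mul_add, add_mul]
      map_smul' := fun c A => by
        simp only [twirl_eq_integral, RingHom.id_apply]
        rw [← integral_smul]
        simp only [twirlIntegrand, mul_smul_comm, smul_mul_assoc] }

theorem twirlCLM_apply (A : SuperOp n) : twirlCLM n A = twirl A := rfl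

theorem twirl_mul_of_commute {A B : SuperOp n}
    (hB : ∀ U : UGroup n, conjBy (U : Matrix (Fin n) (Fin n) ℂ) * B =
      B * conjBy (U : Matrix (Fin n) (Fin n) ℂ)) : twirl (A * B) = twirl A * B := by
  rw [twirl_eq_integral, twirl_eq_integral, ← integral_mul_const_of_integrable
    (integrable_twirlIntegrand A)]
  congr 1
  funext U
  simp only [twirlIntegrand, mul_assoc, hB]

theorem twirl_mul_of_commute' {A B : SuperOp n}
    (hB : ∀ U : UGroup n, conjBy (U : Matrix (Fin n) (Fin n) ℂ) * B =
      B * conjBy (U : Matrix (Fin n) (Fin n) ℂ)) : twirl (B * A) = B * twirl A := by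
  rw [twirl_eq_integral, twirl_eq_integral, ← integral_const_mul_of_integrable
    (integrable_twirlIntegrand A)]
  congr 1
  funext U
  have h := hB U⁻¹
  have h2 : ((U⁻¹ : UGroup n) : Matrix (Fin n) (Fin n) ℂ) =
    (U : Matrix (Fin n) (Fin n) ℂ).conjTranspose := rfl
  rw [h2] at h
  simp only [twirlIntegrand, ← mul_assoc, h]

theorem twirl_one : twirl (1 : SuperOp n) = 1 := by
  rw [twirl_eq_integral]
  simp [twirlIntegrand, ← conjBy_mul, UGroup.conjTranspose_mul_self, conjBy_one]

/-- Substitute $U\mapsto UV$ in the Haar integral. -/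
theorem conjBy_mul_twirl (A : SuperOp n) (V : UGroup n) :
    conjBy (V : Matrix (Fin n) (Fin n) ℂ) * twirl A =
      twirl A * conjBy (V : Matrix (Fin n) (Fin n) ℂ) := by
  have hV : conjBy (V : Matrix (Fin n) (Fin n) ℂ) *
      conjBy (V : Matrix (Fin n) (Fin n) ℂ).conjTranspose = 1 := by
    rw [← conjBy_mul, UGroup.self_mul_conjTranspose, conjBy_one]
  rw [twirl_eq_integral, ← integral_mul_const_of_integrable (integrable_twirlIntegrand A),
    ← integral_mul_right_eq_self _ V, ← integral_const_mul_of_integrable]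
  · congr 1
    funext U
    simp only [twirlIntegrand, Submonoid.coe_mul, Matrix.conjTranspose_mul, conjBy_mul]
    simp only [← mul_assoc, hV, one_mul]
  · exact (integrable_twirlIntegrand A).comp_mul_right V

end Twirl

/-! ### Scalar matrices and the trace projection. -/

/-- Unitaries span a C*-algebra, so `B` is central in the full matrix algebra. -/
theorem Matrix.exists_eq_smul_one_of_commute_unitary {n : ℕ} (B : Matrix (Fin n) (Fin n) ℂ)
    (h : ∀ U : UGroup n, (U : Matrix (Fin n) (Fin n) ℂ) * B = B * U) :
    ∃ b : ℂ, B = b • (1 : Matrix (Fin n) (Fin n) ℂ) := by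
  have hall : ∀ M : Matrix (Fin n) (Fin n) ℂ, M * B = B * M := by
    intro M
    have hM : M ∈ Submodule.span ℂ (unitary (Matrix (Fin n) (Fin n) ℂ) : Set _) := by
      rw [CStarAlgebra.span_unitary]; trivial
    induction hM using Submodule.span_induction with
    | mem x hx => exact h ⟨x, hx⟩
    | zero => simp
    | add x y _ _ hx hy => rw [add_mul, mul_add, hx, hy]
    | smul a x _ hx => rw [smul_mul_assoc, mul_smul_comm, hx]
  obtain ⟨b, hb⟩ := Matrix.mem_range_scalar_of_commute_single (M := B) fun i j _ => hall _
  exact ⟨b, by rw [← hb, Matrix.scalar_apply, Matrix.smul_one_eq_diagonal]⟩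

section TraceProj

variable {n : ℕ}

variable (n) in
/-- The completely depolarizing superoperator `X ↦ (Tr X / n) I`. -/
noncomputable def traceProj : SuperOp n :=
  SuperOp.ofLinear ((1 / (n : ℂ)) •
    (Matrix.traceLinearMap (Fin n) ℂ ℂ).smulRight (1 : Matrix (Fin n) (Fin n) ℂ))

theorem traceProj_apply (X : Matrix (Fin n) (Fin n) ℂ) :
    traceProj n X = (X.trace / (n : ℂ)) • (1 : Matrix (Fin n) (Fin n) ℂ) := by
  rw [traceProj, SuperOp.ofLinear_apply]
  simp [smul_smul, div_eq_inv_mul]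

theorem traceProj_mul_self (hn : n ≠ 0) : traceProj n * traceProj n = traceProj n := by
  refine SuperOp.ext fun X => ?_
  have : (n : ℂ) ≠ 0 := Nat.cast_ne_zero.2 hn
  simp only [SuperOp.mul_apply, traceProj_apply, Matrix.trace_smul, Matrix.trace_one,
    Fintype.card_fin, smul_eq_mul]
  rw [div_mul_cancel₀ _ this]

theorem traceProj_mul_eq_zero {A : SuperOp n} (hA : ∀ X, (A X).trace = 0) :
    traceProj n * A = 0 := by
  refine SuperOp.ext fun X => ?_
  rw [SuperOp.mul_apply, traceProj_apply, hA, zero_div, zero_smul]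
  rfl

theorem conjBy_mul_traceProj (U : UGroup n) :
    conjBy (U : Matrix (Fin n) (Fin n) ℂ) * traceProj n =
      traceProj n * conjBy (U : Matrix (Fin n) (Fin n) ℂ) := by
  refine SuperOp.ext fun X => ?_
  simp only [SuperOp.mul_apply, traceProj_apply, conjBy_apply]
  rw [Matrix.mul_smul, Matrix.smul_mul, mul_one, UGroup.self_mul_conjTranspose,
    Matrix.trace_mul_cycle, UGroup.conjTranspose_mul_self, one_mul]

theorem freeGenerator_eq (γ p : ℝ) :
    freeGenerator n γ p = (-(γ * (1 - p) : ℝ) : ℂ) • (1 - traceProj n) := by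
  refine SuperOp.ext fun X => ?_
  simp only [freeGenerator, SuperOp.smul_apply, SuperOp.sub_apply, SuperOp.one_apply,
    traceProj_apply, depolarizing, SuperOp.ofLinear_apply, LinearMap.add_apply,
    LinearMap.smul_apply, LinearMap.id_apply, LinearMap.smulRight_apply,
    Matrix.traceLinearMap_apply, smul_sub, smul_add, smul_smul]
  push_cast
  module

/-- Only scalar matrices commute with the unitary group, so the twirl of a superoperator with
traceless range annihilates the identity matrix. -/
theorem twirl_mul_traceProj_eq_zero (hn : n ≠ 0) {A : SuperOp n} (hA : traceProj n * A = 0) :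
    twirl A * traceProj n = 0 := by
  have hn' : (n : ℂ) ≠ 0 := Nat.cast_ne_zero.2 hn
  have h0 : traceProj n * twirl A = 0 := by
    rw [← twirl_mul_of_commute' conjBy_mul_traceProj, hA, ← twirlCLM_apply, map_zero]
  have h1 : twirl A 1 = 0 := by
    -- Conjugation fixes $I$, so `twirl A 1` commutes with every unitary; being scalar and
    -- traceless, it is zero.
    obtain ⟨b, hb⟩ := Matrix.exists_eq_smul_one_of_commute_unitary (twirl A 1) fun U => by
      have h := congrArg (fun B : SuperOp n => B 1) (conjBy_mul_twirl A U)
      simp only [SuperOp.mul_apply, conjBy_apply, mul_one, UGroup.self_mul_conjTranspose] at h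
      calc (U : Matrix (Fin n) (Fin n) ℂ) * twirl A 1
          = (U : Matrix (Fin n) (Fin n) ℂ) * twirl A 1 *
            ((U : Matrix (Fin n) (Fin n) ℂ).conjTranspose * U) := by
            rw [UGroup.conjTranspose_mul_self, mul_one]
        _ = twirl A 1 * U := by rw [← mul_assoc, h]
    have h2 := congrArg (fun B : SuperOp n => B 1) h0
    simp only [SuperOp.mul_apply] at h2
    rw [traceProj_apply, hb, Matrix.trace_smul, Matrix.trace_one, Fintype.card_fin, smul_eq_mul,
      mul_div_cancel_right₀ _ hn', ← hb] at h2
    exact h2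
  refine SuperOp.ext fun X => ?_
  rw [SuperOp.mul_apply, traceProj_apply, SuperOp.apply_smul, h1, smul_zero]
  rfl

end TraceProj

/-! ### Linear differential equations with constant generator. -/

section ConstantDerivative

variable {A : Type*} [NormedRing A] [NormedAlgebra ℝ A]

theorem mul_eq_of_hasDerivAt_mul {f : ℝ → A} {G E : A} (hf : ∀ t, HasDerivAt f (G * f t) t)
    (hE : E * G = 0) (s t : ℝ) : E * f t = E * f s := by
  have h : ∀ t, HasDerivAt (fun t => E * f t) 0 t := fun t => by
    have := (hf t).const_mul E
    rwa [← mul_assoc, hE, zero_mul] at this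
  exact is_const_of_deriv_eq_zero (fun t => (h t).differentiableAt) (fun t => (h t).deriv) t s

/-- The product $e^{-(t-t_0)G}f(t)$ has zero derivative. -/
theorem eq_exp_smul_mul_of_hasDerivAt_mul [CompleteSpace A] {f : ℝ → A} {G : A} {t₀ : ℝ}
    (hf : ∀ t, HasDerivAt f (G * f t) t) (t : ℝ) :
    f t = NormedSpace.exp ((t - t₀) • G) * f t₀ := by
  have h0 : ∀ t, HasDerivAt (fun t : ℝ => NormedSpace.exp (-(t - t₀) • G))
      (-(NormedSpace.exp (-(t - t₀) • G) * G)) t := fun t => by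
    have h := (hasDerivAt_exp_smul_const (𝕂 := ℝ) G (-(t - t₀))).scomp t
      ((hasDerivAt_id t).sub_const t₀).neg
    simpa [Function.comp_def] using h
  have h : ∀ t, HasDerivAt (fun t => NormedSpace.exp (-(t - t₀) • G) * f t) 0 t := fun t => by
    have := (h0 t).mul (hf t)
    rwa [neg_mul, mul_assoc, neg_add_cancel] at this
  have hc := is_const_of_deriv_eq_zero (fun t => (h t).differentiableAt)
    (fun t => (h t).deriv) t t₀
  simp only [sub_self, neg_zero, zero_smul, NormedSpace.exp_zero, one_mul] at hc
  rw [← hc, ← mul_assoc]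
  let _ : NormedAlgebra ℚ A := NormedAlgebra.restrictScalars ℚ ℝ A
  have hcomm : Commute ((t - t₀) • G) (-(t - t₀) • G) := by
    rw [neg_smul]; exact (Commute.refl _).neg_right
  rw [← NormedSpace.exp_add_of_commute hcomm, neg_smul, add_neg_cancel, NormedSpace.exp_zero,
    one_mul]

end ConstantDerivative

/-! ### The twirled propagator and its generator. -/

section Propagator

variable {n : ℕ}

/-- `exp (z L_I)` twirled. -/
noncomputable def twirlExp (LI : SuperOp n) (z : ℂ) : SuperOp n :=
  twirl (NormedSpace.exp (z • LI))

/-- The derivative of `twirlExp`. -/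
noncomputable def twirlExpDeriv (LI : SuperOp n) (z : ℂ) : SuperOp n :=
  twirl (LI * NormedSpace.exp (z • LI))

/-- The generator of the twirled propagator. -/
noncomputable def twirlGenerator (L₀ LI : SuperOp n) (lam : ℂ) (t t₀ : ℝ) : SuperOp n :=
  L₀ + lam • (twirlExpDeriv LI (lam * ((t - t₀ : ℝ) : ℂ)) *
    Ring.inverse (twirlExp LI (lam * ((t - t₀ : ℝ) : ℂ))))

theorem hasDerivAt_twirlExp (LI : SuperOp n) (z : ℂ) :
    HasDerivAt (twirlExp LI) (twirlExpDeriv LI z) z :=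
  (twirlCLM n).hasFDerivAt.comp_hasDerivAt z (hasDerivAt_exp_smul_const' LI z)

theorem twirlExp_zero (LI : SuperOp n) : twirlExp LI 0 = 1 := by
  rw [twirlExp, zero_smul, NormedSpace.exp_zero, twirl_one]

theorem traceProj_mul_exp {LI : SuperOp n} (hLI : traceProj n * LI = 0) (z : ℂ) :
    traceProj n * NormedSpace.exp (z • LI) = traceProj n := by
  have h := mul_eq_of_hasDerivAt_mul (E := traceProj n) (G := z • LI)
    (f := fun t : ℝ => NormedSpace.exp (t • (z • LI)))
    (fun t => hasDerivAt_exp_smul_const' (z • LI) t) (by rw [mul_smul_comm, hLI, smul_zero]) 0 1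
  simpa using h

theorem twirlExp_mul_traceProj (hn : n ≠ 0) {LI : SuperOp n} (hLI : traceProj n * LI = 0) (z : ℂ) :
    twirlExp LI z * traceProj n = traceProj n := by
  have h : traceProj n * (NormedSpace.exp (z • LI) - 1) = 0 := by
    rw [mul_sub, traceProj_mul_exp hLI, mul_one, sub_self]
  have h2 := twirl_mul_traceProj_eq_zero hn h
  rw [← twirlCLM_apply, map_sub, twirlCLM_apply, twirlCLM_apply, twirl_one, sub_mul, one_mul,
    sub_eq_zero] at h2
  exact h2

theorem traceProj_mul_twirlExp {LI : SuperOp n} (hLI : traceProj n * LI = 0) (z : ℂ) :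
    traceProj n * twirlExp LI z = traceProj n := by
  rw [twirlExp, ← twirl_mul_of_commute' conjBy_mul_traceProj, traceProj_mul_exp hLI]
  have := twirl_mul_of_commute' (A := 1) (conjBy_mul_traceProj (n := n))
  rwa [mul_one, twirl_one, mul_one] at this

theorem twirlExpDeriv_mul_traceProj (hn : n ≠ 0) {LI : SuperOp n} (hLI : traceProj n * LI = 0)
    (z : ℂ) : twirlExpDeriv LI z * traceProj n = 0 :=
  twirl_mul_traceProj_eq_zero hn (by rw [← mul_assoc, hLI, zero_mul])

theorem twirl_propagator (hn : n ≠ 0) {LI : SuperOp n} (hLI : traceProj n * LI = 0)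
    {c : ℝ} {lam : ℂ} {Φ : ℝ → ℝ → SuperOp n}
    (hΦ : IsPropagator ((-c : ℂ) • (1 - traceProj n) + lam • LI) Φ) (t t₀ : ℝ) :
    twirl (Φ t t₀) = traceProj n + (Real.exp (-c * (t - t₀)) : ℂ) •
      (twirlExp LI (lam * ((t - t₀ : ℝ) : ℂ)) - traceProj n) := by
  obtain ⟨h0, hd⟩ := hΦ t₀
  have hPP := traceProj_mul_self hn
  have hPG : traceProj n * ((-c : ℂ) • (1 - traceProj n) + lam • LI) = 0 := by
    rw [mul_add, mul_smul_comm, mul_smul_comm, hLI, mul_sub, mul_one, hPP, sub_self, smul_zero,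
      smul_zero, add_zero]
  have hP : ∀ s, traceProj n * Φ s t₀ = traceProj n := fun s => by
    have := mul_eq_of_hasDerivAt_mul hd hPG t₀ s
    rwa [h0, mul_one] at this
  have hQ : Φ t t₀ * (1 - traceProj n) = (Real.exp (-c * (t - t₀)) : ℂ) •
      (NormedSpace.exp ((lam * ((t - t₀ : ℝ) : ℂ)) • LI) * (1 - traceProj n)) := by
    -- Since $P\Phi(1-P)=P(1-P)=0$, the factor $1-P$ in the free generator acts here as the
    -- identity.
    have h1 : ∀ s, HasDerivAt (fun s => Φ s t₀ * (1 - traceProj n))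
        (((-c : ℂ) • 1 + lam • LI) * (Φ s t₀ * (1 - traceProj n))) s := fun s => by
      convert (hd s).mul_const (1 - traceProj n) using 1
      simp only [add_mul, smul_mul_assoc, sub_mul, one_mul, hP, mul_sub, mul_one, hPP, mul_assoc]
      module
    have h2 := eq_exp_smul_mul_of_hasDerivAt_mul (t₀ := t₀) h1 t
    rw [h0, one_mul] at h2
    rw [h2, ← smul_mul_assoc]
    congr 1
    let _ : NormedAlgebra ℚ (SuperOp n) := NormedAlgebra.restrictScalars ℚ ℂ (SuperOp n)
    have h3 : (t - t₀) • ((-c : ℂ) • (1 : SuperOp n) + lam • LI) =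
        algebraMap ℂ (SuperOp n) ((-c * (t - t₀) : ℝ) : ℂ) +
          (lam * ((t - t₀ : ℝ) : ℂ)) • LI := by
      rw [Algebra.algebraMap_eq_smul_one, ← Complex.coe_smul]
      push_cast
      module
    rw [h3, NormedSpace.exp_add_of_commute (Algebra.commutes _ _),
      ← NormedSpace.algebraMap_exp_comm, ← Complex.exp_eq_exp_ℂ, ← Complex.ofReal_exp,
      Algebra.algebraMap_eq_smul_one, smul_mul_assoc, one_mul]
  have hPt : twirl (Φ t t₀) * traceProj n = traceProj n := by
    have h : traceProj n * (Φ t t₀ - 1) = 0 := by rw [mul_sub, hP, mul_one, sub_self]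
    have h2 := twirl_mul_traceProj_eq_zero hn h
    rw [← twirlCLM_apply, map_sub, twirlCLM_apply, twirlCLM_apply, twirl_one, sub_mul, one_mul,
      sub_eq_zero] at h2
    exact h2
  have hcomm : ∀ U : UGroup n, conjBy (U : Matrix (Fin n) (Fin n) ℂ) * (1 - traceProj n) =
      (1 - traceProj n) * conjBy (U : Matrix (Fin n) (Fin n) ℂ) := fun U => by
    rw [mul_sub, sub_mul, conjBy_mul_traceProj, mul_one, one_mul]
  have hQt := congrArg (twirlCLM n) hQ
  rw [map_smul, twirlCLM_apply, twirlCLM_apply, twirl_mul_of_commute hcomm,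
    twirl_mul_of_commute hcomm, mul_sub (twirl (Φ t t₀)), mul_one, hPt,
    mul_sub (twirl (NormedSpace.exp _)), mul_one] at hQt
  change _ = (Real.exp (-c * (t - t₀)) : ℂ) • (twirlExp LI (lam * ((t - t₀ : ℝ) : ℂ)) -
    twirlExp LI (lam * ((t - t₀ : ℝ) : ℂ)) * traceProj n) at hQt
  rw [twirlExp_mul_traceProj hn hLI] at hQt
  rw [← hQt]
  abel

theorem isUnit_twirl_propagator (hn : n ≠ 0) {LI : SuperOp n} (hLI : traceProj n * LI = 0)
    {c : ℝ} {lam : ℂ} {Φ : ℝ → ℝ → SuperOp n}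
    (hΦ : IsPropagator ((-c : ℂ) • (1 - traceProj n) + lam • LI) Φ) {t t₀ : ℝ}
    (hu : IsUnit (twirlExp LI (lam * ((t - t₀ : ℝ) : ℂ)))) :
    IsUnit (twirl (Φ t t₀)) := by
  rw [twirl_propagator hn hLI hΦ]
  have hPP := traceProj_mul_self hn
  have hTP := twirlExp_mul_traceProj hn hLI (lam * ((t - t₀ : ℝ) : ℂ))
  have hPT := traceProj_mul_twirlExp hLI (lam * ((t - t₀ : ℝ) : ℂ))
  have ha : (Real.exp (-c * (t - t₀)) : ℂ) ≠ 0 := by exact_mod_cast (Real.exp_pos _).ne'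
  generalize (Real.exp (-c * (t - t₀)) : ℂ) = a at ha
  generalize twirlExp LI (lam * ((t - t₀ : ℝ) : ℂ)) = T at hu hTP hPT
  obtain ⟨u, rfl⟩ := hu
  have hiP : (↑u⁻¹ : SuperOp n) * traceProj n = traceProj n := by
    rw [Units.inv_mul_eq_iff_eq_mul, hTP]
  have hPi : traceProj n * (↑u⁻¹ : SuperOp n) = traceProj n := by
    rw [Units.mul_inv_eq_iff_eq_mul, hPT]
  -- $T$ fixes $P$ from both sides, so $P+a(T-P)$ is inverted separately on the ranges of $P$ and
  -- $1-P$.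
  refine ⟨⟨_, traceProj n + a⁻¹ • ((↑u⁻¹ : SuperOp n) - traceProj n), ?_, ?_⟩, rfl⟩
  · simp only [add_mul, mul_add, mul_sub, sub_mul, smul_mul_assoc, mul_smul_comm,
      smul_add, smul_sub, inv_smul_smul₀ ha, hPP, hPi, hTP, Units.mul_inv]
    abel
  · simp only [add_mul, mul_add, mul_sub, sub_mul, smul_mul_assoc, mul_smul_comm,
      smul_add, smul_sub, smul_inv_smul₀ ha, hPP, hPT, hiP, Units.inv_mul]
    abel

theorem hasDerivAt_twirl_propagator (hn : n ≠ 0) {LI : SuperOp n} (hLI : traceProj n * LI = 0)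
    {c : ℝ} {lam : ℂ} {Φ : ℝ → ℝ → SuperOp n}
    (hΦ : IsPropagator ((-c : ℂ) • (1 - traceProj n) + lam • LI) Φ) {t t₀ : ℝ}
    (hu : IsUnit (twirlExp LI (lam * ((t - t₀ : ℝ) : ℂ)))) :
    HasDerivAt (fun s => twirl (Φ s t₀))
      (twirlGenerator ((-c : ℂ) • (1 - traceProj n)) LI lam t t₀ * twirl (Φ t t₀)) t := by
  have hPP := traceProj_mul_self hn
  have hPT := traceProj_mul_twirlExp hLI (lam * ((t - t₀ : ℝ) : ℂ))
  have hTP := twirlExp_mul_traceProj hn hLI (lam * ((t - t₀ : ℝ) : ℂ))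
  have hDP := twirlExpDeriv_mul_traceProj hn hLI (lam * ((t - t₀ : ℝ) : ℂ))
  have hE : HasDerivAt (fun s : ℝ => (Real.exp (-c * (s - t₀)) : ℂ))
      ((-c : ℂ) * (Real.exp (-c * (t - t₀)) : ℂ)) t := by
    have h := ((((hasDerivAt_id t).sub_const t₀).const_mul (-c)).exp).ofReal_comp
    refine h.congr_deriv ?_
    simp only [id_eq, mul_one, Complex.ofReal_mul, Complex.ofReal_neg]
    exact mul_comm _ _
  have hz : HasDerivAt (fun s : ℝ => lam * ((s - t₀ : ℝ) : ℂ)) lam t := by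
    have h := (((hasDerivAt_id t).sub_const t₀).ofReal_comp).const_mul lam
    simpa using h
  have hT : HasDerivAt (fun s : ℝ => twirlExp LI (lam * ((s - t₀ : ℝ) : ℂ)))
      (lam • twirlExpDeriv LI (lam * ((t - t₀ : ℝ) : ℂ))) t :=
    (hasDerivAt_twirlExp LI _).scomp t hz
  have hm := (hE.smul (hT.sub_const (traceProj n))).const_add (traceProj n)
  simp only [twirl_propagator hn hLI hΦ]
  refine hm.congr_deriv ?_
  rw [twirlGenerator]
  generalize (Real.exp (-c * (t - t₀)) : ℂ) = a
  generalize twirlExp LI (lam * ((t - t₀ : ℝ) : ℂ)) = T at hu hTP hPT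
  generalize twirlExpDeriv LI (lam * ((t - t₀ : ℝ) : ℂ)) = D at hDP
  -- With $T'P=0$ this gives $T'T^{-1}P=0$, so the interaction part of the generator sees only the
  -- $aT$ summand.
  have hiP : Ring.inverse T * traceProj n = traceProj n := by
    rw [← hTP, ← mul_assoc, Ring.inverse_mul_cancel _ hu, one_mul, hTP]
  simp only [add_mul, mul_add, mul_sub, sub_mul, smul_mul_assoc, mul_smul_comm, mul_assoc, one_mul,
    hPP, hPT, hiP, hDP, Ring.inverse_mul_cancel _ hu, mul_one, sub_self, smul_zero, sub_zero,
    zero_add, smul_sub, smul_smul]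
  module

/-! ### Expansion of the generator in the coupling. -/

theorem cumulant_zero (L₀ LI : SuperOp n) (t t₀ : ℝ) : cumulant L₀ LI t t₀ 0 = L₀ := rfl

theorem cumulant_succ (L₀ LI : SuperOp n) (t t₀ : ℝ) (k : ℕ) :
    cumulant L₀ LI t t₀ (k + 1) =
      ((t - t₀ : ℝ) : ℂ) ^ k • orderedCumulant (fun j => twirl (LI ^ j)) (k + 1) := by
  simp only [cumulant, orderedCumulant, orderedTerm, Nat.add_sub_cancel, Complex.ofReal_pow]
  rfl

theorem isBigO_twirlExp (LI : SuperOp n) (N : ℕ) :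
    (fun z => twirlExp LI z -
      ∑ k ∈ Finset.range N, z ^ k • ((1 / (Nat.factorial k : ℂ)) • twirl (LI ^ k)))
      =O[𝓝 0] fun z : ℂ => z ^ N := by
  refine (((twirlCLM n).isBigO_comp _ _).trans (isBigO_exp_smul_sub_sum LI N)).congr_left
    fun z => ?_
  simp only [map_sub, map_sum, map_smul, twirlCLM_apply, twirlExp]

theorem isBigO_twirlExpDeriv (LI : SuperOp n) (N : ℕ) :
    (fun z => twirlExpDeriv LI z -
      ∑ k ∈ Finset.range N, z ^ k • ((1 / (Nat.factorial k : ℂ)) • twirl (LI ^ (k + 1))))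
      =O[𝓝 0] fun z : ℂ => z ^ N := by
  have h := (isBigO_const_const LI (one_ne_zero (α := ℂ)) (𝓝 0)).mul
    (isBigO_exp_smul_sub_sum LI N)
  simp only [one_mul] at h
  refine (((twirlCLM n).isBigO_comp _ _).trans h).congr_left fun z => ?_
  simp only [mul_sub, Finset.mul_sum, mul_smul_comm, ← pow_succ', map_sub, map_sum, map_smul,
    twirlCLM_apply, twirlExpDeriv]

theorem isBigO_twirlGenerator (L₀ LI : SuperOp n) (t t₀ : ℝ) (N : ℕ) :
    (fun lam : ℂ => twirlGenerator L₀ LI lam t t₀ -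
      ∑ k ∈ Finset.range (N + 1), lam ^ k • cumulant L₀ LI t t₀ k)
      =O[𝓝 0] fun lam : ℂ => lam ^ (N + 1) := by
  have hV := isBigO_mul_inverse_sub_sum (isBigO_twirlExp LI) (isBigO_twirlExpDeriv LI)
    (hasDerivAt_twirlExp LI 0).continuousAt (twirlExp_zero LI)
    (sum_orderedCumulant_mul (fun j => twirl (LI ^ j)) (by simp only [pow_zero, twirl_one])) N
  have ht : Tendsto (fun lam : ℂ => lam * ((t - t₀ : ℝ) : ℂ)) (𝓝 0) (𝓝 0) := by
    have : Continuous fun lam : ℂ => lam * ((t - t₀ : ℝ) : ℂ) := by fun_prop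
    simpa using this.tendsto 0
  have h1 : (fun lam : ℂ => (lam * ((t - t₀ : ℝ) : ℂ)) ^ N) =O[𝓝 0] fun lam : ℂ => lam ^ N := by
    refine IsBigO.of_bound (‖((t - t₀ : ℝ) : ℂ)‖ ^ N) (Eventually.of_forall fun z => ?_)
    rw [mul_pow, norm_mul, norm_pow ((t - t₀ : ℝ) : ℂ), mul_comm]
  -- The prefactor $\lambda$ raises the order from $N$ to $N+1$ and turns $(\lambda\tau)^k$ into
  -- $\lambda^{k+1}\tau^k$, hence the exponent $k-1$ of $t-t_0$ in the cumulants.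
  have h2 := (isBigO_refl (fun lam : ℂ => lam) (𝓝 0)).smul ((hV.comp_tendsto ht).trans h1)
  refine h2.congr (fun lam => ?_) fun lam => by rw [smul_eq_mul, pow_succ']
  rw [Finset.sum_range_succ']
  simp only [cumulant_zero, cumulant_succ, twirlGenerator, Function.comp_apply, smul_sub,
    Finset.smul_sum, smul_smul, pow_zero, one_smul, mul_pow, pow_succ', mul_assoc]
  abel

theorem exists_isUnit_twirlExp (LI : SuperOp n) :
    ∃ ε : ℝ, 0 < ε ∧ ∀ z : ℂ, ‖z‖ < ε → IsUnit (twirlExp LI z) := by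
  have h : ∀ᶠ z in 𝓝 (0 : ℂ), IsUnit (twirlExp LI z) :=
    (hasDerivAt_twirlExp LI 0).continuousAt.eventually
      (Units.isOpen.mem_nhds (by simp [twirlExp_zero]))
  obtain ⟨ε, hε, h⟩ := Metric.eventually_nhds_iff.1 h
  exact ⟨ε, hε, fun z hz => h (by simpa using hz)⟩

end Propagator

/-! ### The main theorem. -/

theorem mainTheorem1 (n : ℕ) (hn : 2 ≤ n) (γ p : ℝ) (hγ : 0 < γ)
    (hp : p ∈ Set.Icc (-1 / ((n : ℝ) ^ 2 - 1)) 1)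
    (LI : SuperOp n) (hLI : ∀ X : Matrix (Fin n) (Fin n) ℂ, (LI X).trace = 0)
    (Φ : ℂ → ℝ → ℝ → SuperOp n)
    (hΦ : ∀ lam : ℂ, IsPropagator (freeGenerator n γ p + lam • LI) (Φ lam)) :
    ∃ K : ℂ → ℝ → ℝ → SuperOp n, ∀ t t₀ : ℝ,
      (∃ lam₀ : ℝ, 0 < lam₀ ∧ ∀ lam : ℂ, ‖lam‖ < lam₀ → ∀ s ∈ Set.uIcc t₀ t,
        IsUnit (twirl (Φ lam s t₀)) ∧
        HasDerivAt (fun r => twirl (Φ lam r t₀)) (K lam s t₀ * twirl (Φ lam s t₀)) s) ∧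
      (∀ N : ℕ,
        (fun lam : ℂ => K lam t t₀ -
            ∑ k ∈ Finset.range (N + 1), lam ^ k • cumulant (freeGenerator n γ p) LI t t₀ k)
          =O[𝓝 0] fun lam : ℂ => lam ^ (N + 1)) := by
  have hn0 : n ≠ 0 := by omega
  have hPL : traceProj n * LI = 0 := traceProj_mul_eq_zero hLI
  obtain ⟨ε, hε, hu⟩ := exists_isUnit_twirlExp LI
  -- This radius keeps $|\lambda(s-t_0)|<\varepsilon$ on the whole interval; the `+ 1` covers
  -- $t=t_0$.
  refine ⟨twirlGenerator (freeGenerator n γ p) LI, fun t t₀ =>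
    ⟨⟨ε / (|t - t₀| + 1), by positivity, fun lam hlam s hs => ?_⟩,
      isBigO_twirlGenerator _ LI t t₀⟩⟩
  have hz : ‖lam * ((s - t₀ : ℝ) : ℂ)‖ < ε := by
    rw [norm_mul, Complex.norm_real, Real.norm_eq_abs]
    have h1 : |s - t₀| ≤ |t - t₀| := Set.abs_sub_left_of_mem_uIcc hs
    rw [lt_div_iff₀ (by positivity)] at hlam
    nlinarith [norm_nonneg lam]
  rw [freeGenerator_eq] at hΦ ⊢
  exact ⟨isUnit_twirl_propagator hn0 hPL (hΦ lam) (hu _ hz),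
    hasDerivAt_twirl_propagator hn0 hPL (hΦ lam) (hu _ hz)⟩
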